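/- **Lemma (unbiasedness of the random-horizon estimator).** Let $\mathcal S,\mathcal A$ be finite nonempty sets, $\mathbb P(\cdot\mid s,a)$ a transition probability on $\mathcal S$, $r:\mathcal S\times\mathcal A\to\mathbb R$ a reward function, $\gamma\in(0,1)$, $\lambda\in\mathbb R$ (in particular any $\lambda\ge 0$), and $\rho$ a probability distribution on $\mathcal S$. For $\theta\in\mathbb R^{\mathcal S\times\mathcal A}$ let $\pi_\theta(a\mid s)=\exp(\theta_{s,a})/\sum_{a'\in\mathcal A}\exp(\theta_{s,a'})$ be the soft-max policy. Put $$Q^{\theta}(s,a)=\mathbb E\Big[\sum_{h=0}^\infty\gamma^h r(s_h,a_h)\,\Big|\,s_0=s,a_0=a\Big],\quad V^\theta(s)=\mathbb E_{a\sim\pi_\theta(\cdot\mid s)}[Q^\theta(s,a)],\quad V^\theta(\rho)=\mathbb E_{s\sim\rho}[V^\theta(s)],$$ where $s_{h+1}\sim\mathbb P(\cdot\mid s_h,a_h)$ and $a_{h+1}\sim\pi_\theta(\cdot\mid s_{h+1})$, and define the entropy-regularized objective $$V_\lambda^\theta(\rho)=V^\theta(\rho)+\lambda\,\mathbb E_{s_0\sim\rho,\,a_0\sim\pi_\theta(\cdot\mid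 s_0)}\Big[\sum_{t=0}^\infty-\gamma^t\log\pi_\theta(a_t\mid s_t)\Big].$$ Consider the following sampling scheme. Draw $H\sim\mathrm{Geom}(1-\gamma)$, i.e. $\Pr(H=h)=(1-\gamma)\gamma^h$ for $h=0,1,2,\dots$, and, independently of $H$, a trajectory $(s_0,a_0,s_1,a_1,\dots)$ with $s_0\sim\rho$, $a_h\sim\pi_\theta(\cdot\mid s_h)$, $s_{h+1}\sim\mathbb P(\cdot\mid s_h,a_h)$. Given these, draw a second trajectory $(s'_0,a'_0,s'_1,a'_1,\dots)$ with $s'_0=s_H$, $a'_0=a_H$, $s'_{t+1}\sim\mathbb P(\cdot\mid s'_t,a'_t)$, $a'_{t+1}\sim\pi_\theta(\cdot\mid s'_{t+1})$, and, independently of everything else, $H'\sim\mathrm{Geom}(1-\gamma^{1/2})$, i.e. $\Pr(H'=h)=(1-\gamma^{1/2})\gamma^{h/2}$ for $h=0,1,2,\dots$. Set $$\hat Q^\theta_\lambda(s_H,a_H)=r(s'_0,a'_0)+\sum_{t=1}^{H'}\gamma^{t/2}\big(r(s'_t,a'_t)-\lambda\log\pi_\theta(a'_t\mid s'_t)\big),$$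 $$\hat\nabla V^\theta_\lambda(\rho)=\frac1{1-\gamma}\,\nabla_\theta\log\pi_\theta(a_H\mid s_H)\,\big(\hat Q^\theta_\lambda(s_H,a_H)-\lambda\log\pi_\theta(a_H\mid s_H)\big).$$ Then for every $\theta$ the function $\vartheta\mapsto V^{\vartheta}_\lambda(\rho)$ is differentiable at $\theta$, the random vector $\hat\nabla V^\theta_\lambda(\rho)$ is integrable, and $$\mathbb E\big[\hat\nabla V^\theta_\lambda(\rho)\big]=\nabla_\theta V^\theta_\lambda(\rho).$$ -/

import Mathlib

open MeasureTheory ProbabilityTheory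

noncomputable section

/-- A discounted Markov decision process with (discrete) state space `S` and action space `A`:
`transition (s, a)` is the law of the next state, `reward (s, a)` the instantaneous reward and
`discount` the discount factor `γ ∈ (0, 1)`. -/
structure DiscountedMDP (S A : Type*) [MeasurableSpace S] [MeasurableSpace A] where
  transition : Kernel (S × A) S
  isMarkov : IsMarkovKernel transition
  reward : S × A → ℝ
  discount : ℝ
  discount_pos : 0 < discount
  discount_lt_one : discount < 1

attribute [instance] DiscountedMDP.isMarkov

/-- The soft-max policy `π_θ(a | s) = exp θ_{s,a} / ∑_{a'} exp θ_{s,a'}`. -/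
def softmaxPolicy {S A : Type*} [Fintype A] (θ : EuclideanSpace ℝ (S × A)) (s : S) (a : A) : ℝ :=
  Real.exp (θ (s, a)) / ∑ a' : A, Real.exp (θ (s, a'))

/-- The soft-max policy as a Markov kernel from states to actions. -/
def softmaxKernel {S A : Type*} [Fintype A] [MeasurableSpace S] [DiscreteMeasurableSpace S]
    [MeasurableSpace A] (θ : EuclideanSpace ℝ (S × A)) : Kernel S A where
  toFun s := ∑ a : A, ENNReal.ofReal (softmaxPolicy θ s a) • Measure.dirac a
  measurable' := Measurable.of_discrete

instance softmaxKernel_isMarkov {S A : Type*} [Fintype A] [Nonempty A] [MeasurableSpace S]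
    [DiscreteMeasurableSpace S] [MeasurableSpace A] (θ : EuclideanSpace ℝ (S × A)) :
    IsMarkovKernel (softmaxKernel θ) := by
  refine ⟨fun s => ⟨?_⟩⟩
  have hpos : 0 < ∑ a' : A, Real.exp (θ (s, a')) :=
    Finset.sum_pos (fun a _ => Real.exp_pos _) Finset.univ_nonempty
  change (∑ a : A, ENNReal.ofReal (softmaxPolicy θ s a) • Measure.dirac a) Set.univ = 1
  simp only [Measure.coe_finsetSum, Finset.sum_apply, Measure.smul_apply, measure_univ,
    smul_eq_mul, mul_one]
  rw [← ENNReal.ofReal_sum_of_nonneg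
    (fun a _ => show 0 ≤ softmaxPolicy θ s a from div_nonneg (Real.exp_pos _).le hpos.le)]
  simp only [softmaxPolicy]
  rw [← Finset.sum_div, div_self hpos.ne', ENNReal.ofReal_one]

namespace DiscountedMDP

section

variable {S A : Type*} [Fintype S] [Fintype A] [Nonempty A]
  [MeasurableSpace S] [DiscreteMeasurableSpace S] [MeasurableSpace A] [DiscreteMeasurableSpace A]
  (M : DiscountedMDP S A)

/-- One step of the state-action chain under `π_θ`: from `(s, a)` draw `s' ∼ P(· | s, a)`, then
`a' ∼ π_θ(· | s')`. -/
def stepKernel (θ : EuclideanSpace ℝ (S × A)) : Kernel (S × A) (S × A) :=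
  M.transition ⊗ₖ Kernel.prodMkLeft (S × A) (softmaxKernel θ)

instance stepKernel_isMarkov (θ : EuclideanSpace ℝ (S × A)) : IsMarkovKernel (M.stepKernel θ) := by
  unfold stepKernel; infer_instance

/-- The transition from the history `(s₀, a₀), …, (sₙ, aₙ)` to `(sₙ₊₁, aₙ₊₁)`, which depends on
the last pair only. -/
def historyKernel (θ : EuclideanSpace ℝ (S × A)) (n : ℕ) :
    Kernel ((_ : Finset.Iic n) → S × A) (S × A) :=
  (M.stepKernel θ).comap (fun x => x ⟨n, Finset.mem_Iic.2 le_rfl⟩) (measurable_pi_apply _)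

instance historyKernel_isMarkov (θ : EuclideanSpace ℝ (S × A)) (n : ℕ) :
    IsMarkovKernel (M.historyKernel θ n) := by
  unfold historyKernel; infer_instance

/-- `trajFrom θ (s, a)` is the law, under `π_θ`, of the infinite trajectory
`(s₀, a₀), (s₁, a₁), …` started at `s₀ = s`, `a₀ = a`. -/
def trajFrom (θ : EuclideanSpace ℝ (S × A)) : Kernel (S × A) (ℕ → S × A) :=
  (Kernel.traj (X := fun _ => S × A) (M.historyKernel θ) 0).comap (fun z _ => z)
    (measurable_pi_lambda _ fun _ => measurable_id)

instance trajFrom_isMarkov (θ : EuclideanSpace ℝ (S × A)) : IsMarkovKernel (M.trajFrom θ) := by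
  unfold trajFrom; infer_instance

/-- The law, under `π_θ`, of the infinite trajectory with `s₀ ∼ ρ`, `a₀ ∼ π_θ(· | s₀)`. -/
def trajLaw (ρ : Measure S) (θ : EuclideanSpace ℝ (S × A)) : Measure (ℕ → S × A) :=
  (ρ ⊗ₘ softmaxKernel θ).bind (M.trajFrom θ)

/-- The (unregularized) action-value function
`Q^θ(s, a) = E[∑ₕ γ^h r(sₕ, aₕ) | s₀ = s, a₀ = a]`. -/
def actionValue (θ : EuclideanSpace ℝ (S × A)) (z : S × A) : ℝ :=
  ∫ τ, ∑' h : ℕ, M.discount ^ h * M.reward (τ h) ∂(M.trajFrom θ z)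

/-- `V^θ(s) = E_{a ∼ π_θ(· | s)} [Q^θ(s, a)]`. -/
def stateValue (θ : EuclideanSpace ℝ (S × A)) (s : S) : ℝ :=
  ∫ a, M.actionValue θ (s, a) ∂(softmaxKernel θ s)

/-- `V^θ(ρ) = E_{s₀ ∼ ρ} [V^θ(s₀)]`. -/
def value (ρ : Measure S) (θ : EuclideanSpace ℝ (S × A)) : ℝ :=
  ∫ s, M.stateValue θ s ∂ρ

/-- The discounted entropy `ℍ(ρ, π_θ) = E[∑ₜ -γ^t log π_θ(aₜ | sₜ)]`. -/
def discountedEntropy (ρ : Measure S) (θ : EuclideanSpace ℝ (S × A)) : ℝ :=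
  ∫ τ, ∑' t : ℕ, -(M.discount ^ t * Real.log (softmaxPolicy θ (τ t).1 (τ t).2)) ∂(M.trajLaw ρ θ)

/-- The entropy-regularized objective `V^θ_lam(ρ) = V^θ(ρ) + lam ℍ(ρ, π_θ)`. -/
def regValue (lam : ℝ) (ρ : Measure S) (θ : EuclideanSpace ℝ (S × A)) : ℝ :=
  M.value ρ θ + lam * M.discountedEntropy ρ θ

/-- The law of `H ∼ Geom(1 - γ)`, that is `P(H = h) = (1 - γ) γ^h` for `h = 0, 1, 2, …`. -/
def horizonLaw : Measure ℕ :=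
  geometricMeasure ⟨1 - M.discount, by
    constructor <;> linarith [M.discount_pos, M.discount_lt_one]⟩

/-- The law of `H' ∼ Geom(1 - γ^{1/2})`, that is `P(H' = h) = (1 - γ^{1/2}) γ^{h/2}` for
`h = 0, 1, 2, …`. -/
def rolloutHorizonLaw : Measure ℕ :=
  geometricMeasure ⟨1 - M.discount ^ (1 / 2 : ℝ), by
    have h0 : 0 ≤ M.discount ^ (1 / 2 : ℝ) := Real.rpow_nonneg M.discount_pos.le _
    have h1 : M.discount ^ (1 / 2 : ℝ) ≤ 1 :=
      Real.rpow_le_one M.discount_pos.le M.discount_lt_one.le (by norm_num)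
    constructor <;> linarith⟩

/-- Given the first sample `(H, τ)`, the law of `(H', τ')`: the horizon `H'` is drawn
independently of everything else, and `τ'` is a fresh trajectory started at `(s_H, a_H) = τ H`. -/
def rolloutKernel (θ : EuclideanSpace ℝ (S × A)) :
    Kernel (ℕ × (ℕ → S × A)) (ℕ × (ℕ → S × A)) :=
  Kernel.const _ M.rolloutHorizonLaw ×ₖ
    (M.trajFrom θ).comap (fun x => x.2 x.1)
      (measurable_from_prod_countable_right fun n => measurable_pi_apply n)

/-- The joint law of all the randomness `((H, τ), (H', τ'))` used by the estimator: `H` and the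
trajectory `τ` (started from `ρ`) are independent, and `(H', τ')` is the second rollout. -/
def samplingLaw (ρ : Measure S) (θ : EuclideanSpace ℝ (S × A)) :
    Measure ((ℕ × (ℕ → S × A)) × (ℕ × (ℕ → S × A))) :=
  (M.horizonLaw.prod (M.trajLaw ρ θ)) ⊗ₘ M.rolloutKernel θ

/-- The estimate of the action value computed from the second rollout `(H', τ')`:
`r(s'₀, a'₀) + ∑_{t=1}^{H'} γ^{t/2} (r(s'ₜ, a'ₜ) - lam log π_θ(a'ₜ | s'ₜ))`. -/
def qEstimate (lam : ℝ) (θ : EuclideanSpace ℝ (S × A)) (y : ℕ × (ℕ → S × A)) : ℝ :=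
  M.reward (y.2 0) + ∑ t ∈ Finset.Icc 1 y.1, M.discount ^ ((t : ℝ) / 2) *
    (M.reward (y.2 t) - lam * Real.log (softmaxPolicy θ (y.2 t).1 (y.2 t).2))

/-- The score function `∇_θ log π_θ(a | s)`. -/
def score (θ : EuclideanSpace ℝ (S × A)) (z : S × A) : EuclideanSpace ℝ (S × A) :=
  gradient (fun ϑ : EuclideanSpace ℝ (S × A) => Real.log (softmaxPolicy ϑ z.1 z.2)) θ

/-- The random-horizon policy gradient estimator
`(1 - γ)⁻¹ ∇_θ log π_θ(a_H | s_H) (Q̂(s_H, a_H) - lam log π_θ(a_H | s_H))`, as a function of the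
randomness `x = ((H, τ), (H', τ'))`. -/
def gradEstimator (lam : ℝ) (θ : EuclideanSpace ℝ (S × A))
    (x : (ℕ × (ℕ → S × A)) × (ℕ × (ℕ → S × A))) : EuclideanSpace ℝ (S × A) :=
  ((1 / (1 - M.discount)) * (M.qEstimate lam θ x.2 -
    lam * Real.log (softmaxPolicy θ (x.1.2 x.1.1).1 (x.1.2 x.1.1).2))) •
      score θ (x.1.2 x.1.1)

end

end DiscountedMDP

end

/-! Let `P` be the transition operator of the state-action chain (`stepOp`), a contraction in sup
norm, and `R = (1 - γP)⁻¹` its resolvent. By the Neumann series, `R f` is the expected discounted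
sum of `f` along a trajectory. Hence the objective is the mean of `U = R (r - lam log π)` under `ρ`
and the policy, a finite sum.

Gradient. Fix a direction `v` and let `σ` be the inner product of `v` with the score, `f = σU`.
Differentiating `U - γPU = r - lam log π` gives `(1 - γP) D = γPf - lam σ` for the derivative `D` of
`U`. The score has mean zero under the policy, so `Pσ = 0` and `Rσ = σ`; therefore `D = Rf - f - lam
σ`. In the product rule for the objective, `-f` cancels the term from the policy and `σ` averages to
zero, leaving the mean of `Rf` (`hasFDerivAt_regValue`).

Estimator. Since `P(H' ≥ t) = γ^{t/2}`, truncation at `H'` turns the weight `γ^{t/2}` into `γ^t`, so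
the second rollout estimates `U` without bias (`integral_qEstimate`). Averaging over `H` turns `f`
into `(1 - γ) Rf` (`integral_eval_horizon`), and the prefactor removes `1 - γ`. Both sides thus have
the same inner product with every `v`. -/

set_option linter.unusedSectionVars false

/-! ### The soft-max policy and its score. -/

section Softmax

open DiscountedMDP

variable {S A : Type*} [Fintype A] [Nonempty A]

lemma sum_exp_pos (θ : EuclideanSpace ℝ (S × A)) (s : S) :
    0 < ∑ a : A, Real.exp (θ (s, a)) :=
  Finset.sum_pos (fun _ _ => Real.exp_pos _) Finset.univ_nonempty

lemma softmaxPolicy_pos (θ : EuclideanSpace ℝ (S × A)) (s : S) (a : A) :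
    0 < softmaxPolicy θ s a :=
  div_pos (Real.exp_pos _) (sum_exp_pos θ s)

lemma sum_softmaxPolicy (θ : EuclideanSpace ℝ (S × A)) (s : S) :
    ∑ a : A, softmaxPolicy θ s a = 1 := by
  simp only [softmaxPolicy]
  rw [← Finset.sum_div, div_self (sum_exp_pos θ s).ne']

lemma integral_softmaxKernel [MeasurableSpace S] [DiscreteMeasurableSpace S]
    [MeasurableSpace A] [DiscreteMeasurableSpace A]
    (θ : EuclideanSpace ℝ (S × A)) (s : S) (f : A → ℝ) :
    ∫ a, f a ∂(softmaxKernel θ s) = ∑ a, softmaxPolicy θ s a * f a := by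
  change ∫ a, f a ∂(∑ a : A, ENNReal.ofReal (softmaxPolicy θ s a) • Measure.dirac a) = _
  rw [integral_finsetSum_measure fun a _ => (integrable_dirac (by simp)).smul_measure (by simp)]
  refine Finset.sum_congr rfl fun a _ => ?_
  rw [integral_smul_measure, integral_dirac, ENNReal.toReal_ofReal (softmaxPolicy_pos θ s a).le,
    smul_eq_mul]

variable [Fintype S]

lemma differentiable_softmaxPolicy (s : S) (a : A) :
    Differentiable ℝ fun ϑ : EuclideanSpace ℝ (S × A) => softmaxPolicy ϑ s a := by
  unfold softmaxPolicy
  intro ϑ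
  have hexp : ∀ b : A, DifferentiableAt ℝ
      (fun ϑ : EuclideanSpace ℝ (S × A) => Real.exp (ϑ (s, b))) ϑ := fun b => by fun_prop
  have hsum : DifferentiableAt ℝ
      (fun ϑ : EuclideanSpace ℝ (S × A) => ∑ b : A, Real.exp (ϑ (s, b))) ϑ :=
    DifferentiableAt.fun_sum fun b _ => hexp b
  simpa only [div_eq_mul_inv] using (hexp a).fun_mul (hsum.fun_inv (sum_exp_pos ϑ s).ne')

lemma differentiable_log_softmaxPolicy (s : S) (a : A) :
    Differentiable ℝ fun ϑ : EuclideanSpace ℝ (S × A) => Real.log (softmaxPolicy ϑ s a) :=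
  (differentiable_softmaxPolicy s a).log fun ϑ => (softmaxPolicy_pos ϑ s a).ne'

lemma inner_score (θ v : EuclideanSpace ℝ (S × A)) (z : S × A) :
    inner ℝ v (score θ z) =
      fderiv ℝ (fun ϑ : EuclideanSpace ℝ (S × A) => Real.log (softmaxPolicy ϑ z.1 z.2)) θ v := by
  rw [score, real_inner_comm, gradient, InnerProductSpace.toDual_symm_apply]

/-- The log-derivative trick: `∂ᵥ π_θ(a | s) = π_θ(a | s) ⟪v, ∇ log π_θ(a | s)⟫`. -/
lemma fderiv_softmaxPolicy_apply (θ v : EuclideanSpace ℝ (S × A)) (z : S × A) :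
    fderiv ℝ (fun ϑ : EuclideanSpace ℝ (S × A) => softmaxPolicy ϑ z.1 z.2) θ v =
      softmaxPolicy θ z.1 z.2 * inner ℝ v (score θ z) := by
  have h := (softmaxPolicy_pos θ z.1 z.2).ne'
  rw [inner_score, fderiv.log (differentiable_softmaxPolicy z.1 z.2 θ) h]
  simp [h]

/-- The score has mean zero under the policy. -/
lemma sum_softmaxPolicy_mul_inner_score (θ v : EuclideanSpace ℝ (S × A)) (s : S) :
    ∑ a, softmaxPolicy θ s a * inner ℝ v (score θ (s, a)) = 0 := by
  have h : fderiv ℝ (fun ϑ : EuclideanSpace ℝ (S × A) => ∑ a, softmaxPolicy ϑ s a) θ v = 0 := by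
    simp [sum_softmaxPolicy]
  rw [fderiv_fun_sum fun a _ => differentiable_softmaxPolicy s a θ] at h
  rw [← h]
  simp [fderiv_softmaxPolicy_apply _ _ (s, _)]

end Softmax

/-! ### The transition operator and its resolvent. -/

namespace DiscountedMDP

variable {S A : Type*} [Fintype S] [Fintype A] [Nonempty A]
  [MeasurableSpace S] [DiscreteMeasurableSpace S] [MeasurableSpace A] [DiscreteMeasurableSpace A]
  (M : DiscountedMDP S A)

/-- The expectation of `f (s, a)` for `s ∼ ρ`, `a ∼ π_θ(· | s)`, as a finite sum. -/
lemma integral_compProd_softmaxKernel (ρ : Measure S) [IsProbabilityMeasure ρ]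
    (θ : EuclideanSpace ℝ (S × A)) (f : S × A → ℝ) :
    ∫ z, f z ∂(ρ ⊗ₘ softmaxKernel θ) =
      ∑ w : S × A, softmaxPolicy θ w.1 w.2 * (ρ.real {w.1} * f w) := by
  rw [Measure.integral_compProd .of_finite, integral_fintype .of_finite, Fintype.sum_prod_type]
  refine Finset.sum_congr rfl fun s _ => ?_
  rw [integral_softmaxKernel, smul_eq_mul, Finset.mul_sum]
  exact Finset.sum_congr rfl fun a _ => by ring

/-- The transition operator `f ↦ E[f(s₁, a₁) | s₀, a₀]` of the state-action chain under `π_θ`. -/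
noncomputable def stepOp (θ : EuclideanSpace ℝ (S × A)) : (S × A → ℝ) →L[ℝ] (S × A → ℝ) :=
  ∑ w : S × A, softmaxPolicy θ w.1 w.2 •
    ContinuousLinearMap.pi fun z => (M.transition z).real {w.1} •
      ContinuousLinearMap.proj (R := ℝ) (φ := fun _ : S × A => ℝ) w

lemma stepOp_apply (θ : EuclideanSpace ℝ (S × A)) (f : S × A → ℝ) (z : S × A) :
    M.stepOp θ f z =
      ∑ w : S × A, softmaxPolicy θ w.1 w.2 * ((M.transition z).real {w.1} * f w) := by
  simp [stepOp]

lemma integral_stepKernel (θ : EuclideanSpace ℝ (S × A)) (f : S × A → ℝ) (z : S × A) :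
    ∫ w, f w ∂(M.stepKernel θ z) = M.stepOp θ f z := by
  rw [stepOp_apply, ← integral_compProd_softmaxKernel, stepKernel, Kernel.compProd_apply_eq_compProd_sectR]
  rfl

/-- Averaging against a probability measure does not increase the sup norm; with `γ < 1` this makes
the Neumann series converge. -/
lemma norm_stepOp_le (θ : EuclideanSpace ℝ (S × A)) : ‖M.stepOp θ‖ ≤ 1 := by
  refine ContinuousLinearMap.opNorm_le_bound _ zero_le_one fun f => ?_
  rw [one_mul]
  refine (pi_norm_le_iff_of_nonneg (norm_nonneg f)).2 fun z => ?_
  rw [← integral_stepKernel]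
  simpa using norm_integral_le_of_norm_le_const (μ := M.stepKernel θ z)
    (Filter.Eventually.of_forall fun w => norm_le_pi_norm f w)

lemma norm_discount_smul_stepOp_lt_one (θ : EuclideanSpace ℝ (S × A)) :
    ‖M.discount • M.stepOp θ‖ < 1 := by
  rw [norm_smul, Real.norm_of_nonneg M.discount_pos.le]
  exact (mul_le_of_le_one_right M.discount_pos.le (M.norm_stepOp_le θ)).trans_lt M.discount_lt_one

lemma isUnit_one_sub_stepOp (θ : EuclideanSpace ℝ (S × A)) :
    IsUnit (1 - M.discount • M.stepOp θ) :=
  (Units.oneSub _ (M.norm_discount_smul_stepOp_lt_one θ)).isUnit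

/-- The resolvent `(1 - γ P_θ)⁻¹` of the transition operator. -/
noncomputable def resolventOp (θ : EuclideanSpace ℝ (S × A)) : (S × A → ℝ) →L[ℝ] (S × A → ℝ) :=
  Ring.inverse (1 - M.discount • M.stepOp θ)

lemma hasSum_resolventOp (θ : EuclideanSpace ℝ (S × A)) (f : S × A → ℝ) (z : S × A) :
    HasSum (fun t : ℕ => M.discount ^ t * (M.stepOp θ ^ t) f z) (M.resolventOp θ f z) := by
  have hn := M.norm_discount_smul_stepOp_lt_one θ
  have h : HasSum (fun t : ℕ => (M.discount • M.stepOp θ) ^ t) (M.resolventOp θ) := by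
    rw [resolventOp, NormedRing.inverse_one_sub _ hn]
    exact (summable_geometric_of_norm_lt_one hn).hasSum
  have h2 := (h.mapL (ContinuousLinearMap.apply ℝ (S × A → ℝ) f)).mapL
    (ContinuousLinearMap.proj (R := ℝ) (φ := fun _ : S × A => ℝ) z)
  simpa [smul_pow] using h2

/-- The left inverse identity serves to solve the linear equation satisfied by the derivative of
`U`. -/
lemma resolventOp_sub (θ : EuclideanSpace ℝ (S × A)) (f : S × A → ℝ) :
    M.resolventOp θ (f - M.discount • M.stepOp θ f) = f := by
  have h := Ring.inverse_mul_cancel _ (M.isUnit_one_sub_stepOp θ)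
  simpa [resolventOp] using congrArg (fun T => T f) h

/-- This is the Bellman equation, the identity that is differentiated in `θ`. -/
lemma resolventOp_eq (θ : EuclideanSpace ℝ (S × A)) (f : S × A → ℝ) :
    M.resolventOp θ f - M.discount • M.stepOp θ (M.resolventOp θ f) = f := by
  have h := Ring.mul_inverse_cancel _ (M.isUnit_one_sub_stepOp θ)
  simpa [resolventOp] using congrArg (fun T => T f) h

/-- The `t`-step expectations along a trajectory are given by powers of the transition operator. -/
lemma integral_trajFrom_eval (θ : EuclideanSpace ℝ (S × A)) (t : ℕ) (f : S × A → ℝ) (z : S × A) :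
    ∫ τ, f (τ t) ∂(M.trajFrom θ z) = (M.stepOp θ ^ t) f z := by
  have hf : ∀ (g : S × A → ℝ) (n : ℕ), Measurable fun τ : ℕ → S × A => g (τ n) :=
    fun g n => (Measurable.of_discrete (f := g)).comp (measurable_pi_apply n)
  have hi : ∀ (g : S × A → ℝ) (n : ℕ), Integrable (fun τ : ℕ → S × A => g (τ n))
      (M.trajFrom θ z) := fun g n =>
    Integrable.of_bound (hf g n).aestronglyMeasurable ‖g‖
      (Filter.Eventually.of_forall fun τ => norm_le_pi_norm g (τ n))
  have hz : M.trajFrom θ z =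
      Kernel.traj (X := fun _ => S × A) (M.historyKernel θ) 0 (fun _ => z) := rfl
  induction t generalizing f with
  | zero =>
    rw [hz, Kernel.integral_traj _ (hf f 0).aestronglyMeasurable]
    simp [Function.updateFinset]
  | succ t ih =>
    -- Condition on the history up to time `t`: integrating out the last step replaces `f` at time
    -- `t + 1` by `stepOp f` at time `t`, to which the induction hypothesis applies.
    rw [pow_succ, mul_apply_eq_comp, ← ih, hz,
      ← Kernel.integral_traj_partialTraj (Nat.zero_le t) (by rw [← hz]; exact hi f (t + 1)),
      ← Kernel.traj_map_frestrictLe_apply, integral_map]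
    · refine integral_congr_ae (Filter.Eventually.of_forall fun τ => ?_)
      have h := Kernel.map_traj_succ_self (X := fun _ => S × A) (κ := M.historyKernel θ) (a := t)
      have h2 := congrArg (fun κ => ∫ w, f w ∂(κ (Preorder.frestrictLe t τ))) h
      rw [Kernel.map_apply _ (measurable_pi_apply _), integral_map
        (measurable_pi_apply _).aemeasurable (Measurable.of_discrete).aestronglyMeasurable] at h2
      exact h2.trans (M.integral_stepKernel θ f (τ t))
    · exact (Preorder.measurable_frestrictLe t).aemeasurable
    · refine (StronglyMeasurable.integral_kernel ?_).aestronglyMeasurable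
      exact (hf f (t + 1)).stronglyMeasurable

end DiscountedMDP

/-! ### Tails of the geometric distribution. -/

lemma geometricMeasure_real_Ici {p : unitInterval} (hp : p ≠ 0) (n : ℕ) :
    (geometricMeasure p).real (Set.Ici n) = (1 - p : ℝ) ^ n := by
  induction n with
  | zero =>
    have : Set.Ici 0 = (Set.univ : Set ℕ) := by ext; simp
    simp [this]
  | succ n ih =>
    have h : Set.Ici n = {n} ∪ Set.Ici (n + 1) := by
      ext k; simp; omega
    rw [h, measureReal_union (by simp) (by measurability), geometricMeasure_real_singleton hp] at ih
    rw [pow_succ]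
    linear_combination ih

/-! ### Discounted sums along trajectories and the objective. -/

namespace DiscountedMDP

variable {S A : Type*} [Fintype S] [Fintype A] [Nonempty A]
  [MeasurableSpace S] [DiscreteMeasurableSpace S] [MeasurableSpace A] [DiscreteMeasurableSpace A]
  (M : DiscountedMDP S A)

lemma measurable_comp_eval {α : Type*} [MeasurableSpace α] (f : S × A → α) (t : ℕ) :
    Measurable fun τ : ℕ → S × A => f (τ t) :=
  (Measurable.of_discrete (f := f)).comp (measurable_pi_apply t)

lemma integrable_comp_eval (μ : Measure (ℕ → S × A)) [IsFiniteMeasure μ] (f : S × A → ℝ) (t : ℕ) :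
    Integrable (fun τ : ℕ → S × A => f (τ t)) μ :=
  Integrable.of_bound (measurable_comp_eval f t).aestronglyMeasurable ‖f‖
    (Filter.Eventually.of_forall fun τ => norm_le_pi_norm f (τ t))

lemma norm_discount_pow_mul_le (f : S × A → ℝ) (τ : ℕ → S × A) (t : ℕ) :
    ‖M.discount ^ t * f (τ t)‖ ≤ M.discount ^ t * ‖f‖ := by
  have := M.discount_pos
  rw [norm_mul, Real.norm_of_nonneg (by positivity)]
  gcongr
  exact norm_le_pi_norm f (τ t)

lemma summable_discount_pow_mul (c : ℝ) : Summable fun t : ℕ => M.discount ^ t * c :=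
  (summable_geometric_of_lt_one M.discount_pos.le M.discount_lt_one).mul_right c

lemma integral_tsum_discount (μ : Measure (ℕ → S × A)) [IsProbabilityMeasure μ] (f : S × A → ℝ) :
    ∫ τ, ∑' t : ℕ, M.discount ^ t * f (τ t) ∂μ =
      ∑' t : ℕ, M.discount ^ t * ∫ τ, f (τ t) ∂μ := by
  rw [← integral_tsum_of_summable_integral_norm
    (fun t => (integrable_comp_eval μ f t).const_mul (M.discount ^ t))]
  · simp_rw [integral_const_mul]
  · refine Summable.of_nonneg_of_le (fun t => integral_nonneg fun τ => norm_nonneg _) (fun t => ?_)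
      (M.summable_discount_pow_mul ‖f‖)
    refine (integral_mono ((integrable_comp_eval μ f t).const_mul _).norm (integrable_const _)
      fun τ => M.norm_discount_pow_mul_le f τ t).trans ?_
    simp

lemma integrable_tsum_discount (μ : Measure (ℕ → S × A)) [IsProbabilityMeasure μ]
    (f : S × A → ℝ) : Integrable (fun τ => ∑' t : ℕ, M.discount ^ t * f (τ t)) μ := by
  refine Integrable.of_bound (Measurable.aestronglyMeasurable ?_)
    (∑' t : ℕ, M.discount ^ t * ‖f‖) (Filter.Eventually.of_forall fun τ =>
      tsum_of_norm_bounded (M.summable_discount_pow_mul ‖f‖).hasSum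
        (M.norm_discount_pow_mul_le f τ))
  exact Measurable.tsum fun t => (measurable_comp_eval f t).const_mul _

/-- The expected discounted sum along a trajectory is given by the resolvent. -/
lemma integral_trajFrom_tsum_discount (θ : EuclideanSpace ℝ (S × A)) (f : S × A → ℝ)
    (z : S × A) :
    ∫ τ, ∑' t : ℕ, M.discount ^ t * f (τ t) ∂(M.trajFrom θ z) = M.resolventOp θ f z := by
  rw [integral_tsum_discount, ← (M.hasSum_resolventOp θ f z).tsum_eq]
  simp_rw [integral_trajFrom_eval]

instance trajLaw_isProbabilityMeasure (ρ : Measure S) [IsProbabilityMeasure ρ]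
    (θ : EuclideanSpace ℝ (S × A)) : IsProbabilityMeasure (M.trajLaw ρ θ) := by
  unfold trajLaw; infer_instance

lemma integral_trajLaw (ρ : Measure S) [IsProbabilityMeasure ρ] (θ : EuclideanSpace ℝ (S × A))
    {F : (ℕ → S × A) → ℝ} (hF : Integrable F (M.trajLaw ρ θ)) :
    ∫ τ, F τ ∂(M.trajLaw ρ θ) =
      ∑ w : S × A, softmaxPolicy θ w.1 w.2 * (ρ.real {w.1} * ∫ τ, F τ ∂(M.trajFrom θ w)) := by
  rw [← integral_compProd_softmaxKernel]
  unfold trajLaw at hF ⊢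
  rw [Measure.comp_eq_comp_const_apply] at hF ⊢
  rw [Kernel.integral_comp hF, Kernel.const_apply]

/-- The reward of the entropy-regularized problem, `r(s, a) - lam log π_θ(a | s)`. -/
noncomputable def regReward (lam : ℝ) (θ : EuclideanSpace ℝ (S × A)) (z : S × A) : ℝ :=
  M.reward z - lam * Real.log (softmaxPolicy θ z.1 z.2)

/-- Reward and entropy combine by linearity of the resolvent. The dependence on `θ` is now explicit
in a finite sum, so no derivative has to pass through a trajectory integral. -/
lemma regValue_eq_sum (lam : ℝ) (ρ : Measure S) [IsProbabilityMeasure ρ]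
    (θ : EuclideanSpace ℝ (S × A)) :
    M.regValue lam ρ θ = ∑ w : S × A, softmaxPolicy θ w.1 w.2 *
      (ρ.real {w.1} * M.resolventOp θ (M.regReward lam θ) w) := by
  have hV : M.value ρ θ = ∑ w : S × A, softmaxPolicy θ w.1 w.2 *
      (ρ.real {w.1} * M.resolventOp θ M.reward w) := by
    rw [← integral_compProd_softmaxKernel, Measure.integral_compProd .of_finite]
    simp only [value, stateValue, actionValue, integral_trajFrom_tsum_discount]
  set ℓ : S × A → ℝ := fun z => Real.log (softmaxPolicy θ z.1 z.2) with hℓ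
  have hH : M.discountedEntropy ρ θ = ∑ w : S × A, softmaxPolicy θ w.1 w.2 *
      (ρ.real {w.1} * M.resolventOp θ (-ℓ) w) := by
    simp_rw [← integral_trajFrom_tsum_discount]
    rw [← integral_trajLaw _ _ _ (M.integrable_tsum_discount _ _)]
    simp [discountedEntropy, hℓ]
  have hg : M.regReward lam θ = M.reward + lam • (-ℓ) := by
    ext z; simp [regReward, hℓ, sub_eq_add_neg]
  rw [regValue, hV, hH, hg, Finset.mul_sum, ← Finset.sum_add_distrib]
  refine Finset.sum_congr rfl fun w _ => ?_
  simp only [map_add, map_smul, Pi.add_apply, Pi.smul_apply, smul_eq_mul]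
  ring

/-! ### The second rollout. -/

instance horizonLaw_isProbabilityMeasure : IsProbabilityMeasure M.horizonLaw := by
  unfold horizonLaw; infer_instance

instance rolloutHorizonLaw_isProbabilityMeasure : IsProbabilityMeasure M.rolloutHorizonLaw := by
  unfold rolloutHorizonLaw; infer_instance

lemma sqrt_discount_lt_one : √M.discount < 1 := by
  rw [Real.sqrt_lt' one_pos]; simpa using M.discount_lt_one

lemma rolloutHorizonLaw_real_Ici (t : ℕ) : M.rolloutHorizonLaw.real (Set.Ici t) =
    √M.discount ^ t := by
  have h := M.sqrt_discount_lt_one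
  rw [Real.sqrt_eq_rpow] at h ⊢
  rw [rolloutHorizonLaw, geometricMeasure_real_Ici]
  · simp
  · intro h0
    have := congrArg Subtype.val h0
    simp at this
    norm_num at h
    linarith

lemma discount_rpow_half (t : ℕ) : M.discount ^ ((t : ℝ) / 2) = √M.discount ^ t := by
  rw [Real.sqrt_eq_rpow, ← Real.rpow_natCast, ← Real.rpow_mul M.discount_pos.le]
  congr 1; ring

lemma qEstimate_eq (lam : ℝ) (θ : EuclideanSpace ℝ (S × A)) (y : ℕ × (ℕ → S × A)) :
    M.qEstimate lam θ y = M.reward (y.2 0) +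
      ∑ t ∈ Finset.Icc 1 y.1, √M.discount ^ t * M.regReward lam θ (y.2 t) := by
  simp only [qEstimate, discount_rpow_half, regReward]

lemma measurable_qEstimate (lam : ℝ) (θ : EuclideanSpace ℝ (S × A)) :
    Measurable (M.qEstimate lam θ) := by
  refine measurable_from_prod_countable_right fun n => ?_
  simp only [qEstimate_eq]
  exact (measurable_comp_eval _ 0).add
    (Finset.measurable_fun_sum _ fun t _ => (measurable_comp_eval _ t).const_mul _)

/-- The weights `γ^{t/2}` are summable, so the bound is uniform in the horizon `H'`; integrability
of the estimator follows from boundedness. -/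
lemma norm_qEstimate_le (lam : ℝ) (θ : EuclideanSpace ℝ (S × A)) (y : ℕ × (ℕ → S × A)) :
    ‖M.qEstimate lam θ y‖ ≤
      ‖M.reward‖ + (∑' t : ℕ, √M.discount ^ t) * ‖M.regReward lam θ‖ := by
  rw [qEstimate_eq]
  refine (norm_add_le _ _).trans (add_le_add (norm_le_pi_norm M.reward _) ?_)
  refine (norm_sum_le _ _).trans ?_
  calc ∑ t ∈ Finset.Icc 1 y.1, ‖√M.discount ^ t * M.regReward lam θ (y.2 t)‖
      ≤ ∑ t ∈ Finset.Icc 1 y.1, √M.discount ^ t * ‖M.regReward lam θ‖ := by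
        refine Finset.sum_le_sum fun t _ => ?_
        rw [norm_mul, Real.norm_of_nonneg (by positivity)]
        gcongr
        exact norm_le_pi_norm (M.regReward lam θ) _
    _ = (∑ t ∈ Finset.Icc 1 y.1, √M.discount ^ t) * ‖M.regReward lam θ‖ := by
        rw [Finset.sum_mul]
    _ ≤ _ := by
        gcongr
        exact (summable_geometric_of_lt_one (Real.sqrt_nonneg _)
          M.sqrt_discount_lt_one).sum_le_tsum _ fun t _ => by positivity

/-- By independence, the tail probability `√γ ^ t` multiplies the weight `√γ ^ t`, which gives `γ ^
t`. -/
lemma integral_rolloutHorizonLaw_prod (θ : EuclideanSpace ℝ (S × A)) (f : S × A → ℝ)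
    (t : ℕ) (z : S × A) :
    ∫ y, (Set.Ici t).indicator 1 y.1 * (√M.discount ^ t * f (y.2 t))
      ∂(M.rolloutHorizonLaw.prod (M.trajFrom θ z)) =
      M.discount ^ t * (M.stepOp θ ^ t) f z := by
  rw [integral_prod_mul (fun n : ℕ => (Set.Ici t).indicator (1 : ℕ → ℝ) n)
      (fun τ : ℕ → S × A => √M.discount ^ t * f (τ t)),
    integral_indicator_one (by measurability), rolloutHorizonLaw_real_Ici, integral_const_mul,
    integral_trajFrom_eval, ← mul_assoc, ← mul_pow, Real.mul_self_sqrt M.discount_pos.le]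

/-- The truncated rollout is an unbiased estimate of the regularized action value. -/
lemma integral_qEstimate (lam : ℝ) (θ : EuclideanSpace ℝ (S × A)) (z : S × A) :
    ∫ y, M.qEstimate lam θ y ∂(M.rolloutHorizonLaw.prod (M.trajFrom θ z)) =
      M.resolventOp θ (M.regReward lam θ) z + lam * Real.log (softmaxPolicy θ z.1 z.2) := by
  set g := M.regReward lam θ with hg
  set μ := M.rolloutHorizonLaw.prod (M.trajFrom θ z) with hμ
  -- The random truncation becomes an infinite series of terms cut off by the indicator of `t ≤ H'`,
  -- which can be integrated term by term.
  let F : ℕ → ℕ × (ℕ → S × A) → ℝ := fun t y =>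
    (Set.Ici t).indicator 1 y.1 * (√M.discount ^ t * g (y.2 t))
  have hFm : ∀ t, Measurable (F t) := fun t =>
    ((Measurable.of_discrete (f := (Set.Ici t).indicator (1 : ℕ → ℝ))).comp measurable_fst).mul
      (((measurable_comp_eval g t).comp measurable_snd).const_mul _)
  have hFb : ∀ t y, ‖F t y‖ ≤ √M.discount ^ t * ‖g‖ := fun t y => by
    simp only [F]
    rw [norm_mul, norm_mul, Real.norm_of_nonneg (by positivity : (0 : ℝ) ≤ √M.discount ^ t)]
    have h1 : ‖(Set.Ici t).indicator (1 : ℕ → ℝ) y.1‖ ≤ 1 := by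
      by_cases h : y.1 ∈ Set.Ici t <;> simp [h]
    have h2 := norm_le_pi_norm g (y.2 t)
    calc _ ≤ 1 * (√M.discount ^ t * ‖g‖) := by gcongr
      _ = _ := one_mul _
  have hFi : ∀ t, Integrable (F t) μ := fun t =>
    Integrable.of_bound (hFm t).aestronglyMeasurable _ (Filter.Eventually.of_forall (hFb t))
  have hgeo := (summable_geometric_of_lt_one (Real.sqrt_nonneg _)
    M.sqrt_discount_lt_one).mul_right ‖g‖
  have hsum : HasSum (fun t => ∫ y, F t y ∂μ) (∫ y, ∑' t, F t y ∂μ) := by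
    refine hasSum_integral_of_summable_integral_norm hFi
      (Summable.of_nonneg_of_le (fun t => integral_nonneg fun τ => norm_nonneg _) (fun t => ?_) hgeo)
    refine (integral_mono (hFi t).norm (integrable_const _) (hFb t)).trans ?_
    simp
  have hres : ∫ y, ∑' t, F t y ∂μ = M.resolventOp θ g z := by
    refine hsum.unique ?_
    simp only [F, hμ, integral_rolloutHorizonLaw_prod]
    exact M.hasSum_resolventOp θ g z
  -- The term `t = 0` of the series contains `-lam log π`, whereas the estimate uses the bare reward
  -- there; the added logarithm compensates.
  have hq : ∀ y, M.qEstimate lam θ y =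
      (∑' t, F t y) + lam * Real.log (softmaxPolicy θ (y.2 0).1 (y.2 0).2) := fun y => by
    rw [tsum_eq_sum (s := Finset.range (y.1 + 1)), Finset.sum_range_eq_add_Ico _ (by omega),
      qEstimate_eq]
    · have h1 : Finset.Ico 1 (y.1 + 1) = Finset.Icc 1 y.1 := by ext; simp
      rw [h1]
      have h2 : ∑ t ∈ Finset.Icc 1 y.1, F t y =
          ∑ t ∈ Finset.Icc 1 y.1, √M.discount ^ t * g (y.2 t) :=
        Finset.sum_congr rfl fun t ht => by simp [F, (Finset.mem_Icc.1 ht).2]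
      rw [h2]
      simp [F, hg, regReward]
      ring
    · intro t ht
      have : ¬ t ≤ y.1 := by simpa using ht
      simp [F, this]
  have hℓ := integral_prod_mul (μ := M.rolloutHorizonLaw) (ν := M.trajFrom θ z)
    (fun _ => (1 : ℝ)) (fun τ => lam * Real.log (softmaxPolicy θ (τ 0).1 (τ 0).2))
  rw [integral_const_mul lam,
    M.integral_trajFrom_eval θ 0 (fun w => Real.log (softmaxPolicy θ w.1 w.2))] at hℓ
  simp_rw [hq]
  rw [integral_add, hres]
  · simpa using hℓ
  · refine Integrable.of_bound (Measurable.tsum hFm).aestronglyMeasurable _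
      (Filter.Eventually.of_forall fun y => tsum_of_norm_bounded hgeo.hasSum (hFb · y))
  · refine Integrable.const_mul ?_ lam
    exact (integrable_comp_eval (M.trajFrom θ z)
      (fun w => Real.log (softmaxPolicy θ w.1 w.2)) 0).comp_snd _

/-! ### Differentiability and the policy gradient formula. -/

lemma differentiable_stepOp : Differentiable ℝ M.stepOp := by
  intro θ
  unfold stepOp
  exact DifferentiableAt.fun_sum fun w _ =>
    (differentiable_softmaxPolicy w.1 w.2 θ).smul_const _

lemma differentiable_resolventOp : Differentiable ℝ M.resolventOp := fun θ =>
  (differentiableAt_inverse (𝕜 := ℝ) (M.isUnit_one_sub_stepOp θ)).comp θ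
    ((differentiableAt_const _).sub ((M.differentiable_stepOp θ).const_smul M.discount))

lemma differentiable_regReward_apply (lam : ℝ) (z : S × A) :
    Differentiable ℝ fun ϑ => M.regReward lam ϑ z :=
  (differentiable_const _).sub ((differentiable_log_softmaxPolicy z.1 z.2).const_mul lam)

lemma fderiv_regReward_apply (lam : ℝ) (θ v : EuclideanSpace ℝ (S × A)) (z : S × A) :
    fderiv ℝ (fun ϑ => M.regReward lam ϑ z) θ v = -(lam * inner ℝ v (score θ z)) := by
  have h := (differentiable_log_softmaxPolicy z.1 z.2 θ).hasFDerivAt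
  rw [inner_score]
  have h2 := (h.const_mul lam).const_sub (M.reward z)
  change fderiv ℝ (fun ϑ => M.reward z - lam * Real.log (softmaxPolicy ϑ z.1 z.2)) θ v = _
  rw [h2.fderiv]
  simp

lemma differentiable_resolventOp_regReward (lam : ℝ) :
    Differentiable ℝ fun ϑ => M.resolventOp ϑ (M.regReward lam ϑ) :=
  M.differentiable_resolventOp.clm_apply
    (differentiable_pi.2 fun z => M.differentiable_regReward_apply lam z)

/-- Product rule for an expectation under the soft-max policy, with the derivative of the policy
expressed through the score. -/
lemma hasFDerivAt_sum_softmaxPolicy_mul (c : S → ℝ)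
    {Φ : EuclideanSpace ℝ (S × A) → S × A → ℝ} {θ : EuclideanSpace ℝ (S × A)}
    (hΦ : DifferentiableAt ℝ Φ θ) :
    ∃ L : EuclideanSpace ℝ (S × A) →L[ℝ] ℝ,
      HasFDerivAt (fun ϑ => ∑ w : S × A, softmaxPolicy ϑ w.1 w.2 * (c w.1 * Φ ϑ w)) L θ ∧
      ∀ v, L v = ∑ w : S × A, softmaxPolicy θ w.1 w.2 *
        (c w.1 * (inner ℝ v (score θ w) * Φ θ w + fderiv ℝ Φ θ v w)) := by
  have hw : ∀ w, HasFDerivAt (fun ϑ => Φ ϑ w) _ θ := fun w => hasFDerivAt_pi'.1 hΦ.hasFDerivAt w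
  refine ⟨_, HasFDerivAt.fun_sum fun w _ => (differentiable_softmaxPolicy w.1 w.2 θ).hasFDerivAt.mul
    ((hw w).const_mul (c w.1)), fun v => ?_⟩
  rw [_root_.sum_apply]
  refine Finset.sum_congr rfl fun w _ => ?_
  simp [fderiv_softmaxPolicy_apply]
  ring

/-- Given the next state, the score averages to zero over the next action. Consequently the
resolvent fixes this function. -/
lemma stepOp_inner_score (θ v : EuclideanSpace ℝ (S × A)) :
    M.stepOp θ (fun z => inner ℝ v (score θ z)) = 0 := by
  ext z
  rw [stepOp_apply, Fintype.sum_prod_type]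
  refine Finset.sum_eq_zero fun s _ => ?_
  have h := congrArg ((M.transition z).real {s} * ·) (sum_softmaxPolicy_mul_inner_score θ v s)
  simp only [Finset.mul_sum, mul_zero] at h
  rw [← h]
  exact Finset.sum_congr rfl fun a _ => by ring

/-- The directional derivative of the regularized state-action value
`U_θ = (1 - γ P_θ)⁻¹ (r - lam log π_θ)`. -/
lemma fderiv_resolventOp_regReward (lam : ℝ) (θ v : EuclideanSpace ℝ (S × A)) :
    fderiv ℝ (fun ϑ => M.resolventOp ϑ (M.regReward lam ϑ)) θ v =
      M.resolventOp θ (fun z => inner ℝ v (score θ z) * M.resolventOp θ (M.regReward lam θ) z) -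
        (fun z => inner ℝ v (score θ z) * M.resolventOp θ (M.regReward lam θ) z) -
        lam • fun z => inner ℝ v (score θ z) := by
  set U : EuclideanSpace ℝ (S × A) → S × A → ℝ :=
    fun ϑ => M.resolventOp ϑ (M.regReward lam ϑ) with hU
  have hUd : DifferentiableAt ℝ U θ := M.differentiable_resolventOp_regReward lam θ
  set σ : S × A → ℝ := fun z => inner ℝ v (score θ z) with hσ
  set f : S × A → ℝ := fun z => σ z * U θ z with hf
  set D : S × A → ℝ := fderiv ℝ U θ v with hD
  have key : D - M.discount • M.stepOp θ D = M.discount • M.stepOp θ f - lam • σ := by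
    ext z
    -- Differentiate the Bellman equation at `z`, with the law of the next state as the fixed weight
    -- `c`.
    obtain ⟨L, hL, hLv⟩ := hasFDerivAt_sum_softmaxPolicy_mul
      (fun s => (M.transition z).real {s}) hUd
    have hz : HasFDerivAt (fun ϑ => U ϑ z) _ θ := hasFDerivAt_pi'.1 hUd.hasFDerivAt z
    have h1 := (hz.sub (hL.const_mul M.discount)).fderiv
    have h2 : (fun ϑ => U ϑ z) - (fun ϑ => M.discount * ∑ w : S × A, softmaxPolicy ϑ w.1 w.2 *
        ((M.transition z).real {w.1} * U ϑ w)) = fun ϑ => M.regReward lam ϑ z := by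
      ext ϑ
      have := congrFun (M.resolventOp_eq ϑ (M.regReward lam ϑ)) z
      rw [Pi.sub_apply, Pi.smul_apply, smul_eq_mul, stepOp_apply] at this
      exact this
    rw [h2] at h1
    have h3 := congrArg (fun T => T v) h1
    simp only [fderiv_regReward_apply] at h3
    have h4 : L v = M.stepOp θ f z + M.stepOp θ D z := by
      rw [hLv, ← Pi.add_apply, ← map_add, stepOp_apply]
      rfl
    simp [h4] at h3
    simp only [Pi.sub_apply, Pi.smul_apply, smul_eq_mul]
    simp only [hσ]
    rw [← hD] at h3
    linarith
  -- Apply the resolvent to `key`: `γPf` becomes `Rf - f`, and `σ` stays fixed.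
  have h1 := M.resolventOp_sub θ D
  have h2 := M.resolventOp_sub θ f
  have h3 := M.resolventOp_sub θ σ
  rw [M.stepOp_inner_score θ v, smul_zero, sub_zero] at h3
  rw [map_sub] at h2
  rw [key, map_sub, map_smul (M.resolventOp θ) lam, h3] at h1
  rw [← h1, sub_left_inj]
  linear_combination -h2

/-- The policy gradient formula for the entropy-regularized objective. -/
theorem hasFDerivAt_regValue (lam : ℝ) (ρ : Measure S) [IsProbabilityMeasure ρ]
    (θ : EuclideanSpace ℝ (S × A)) :
    ∃ L : EuclideanSpace ℝ (S × A) →L[ℝ] ℝ, HasFDerivAt (fun ϑ => M.regValue lam ρ ϑ) L θ ∧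
      ∀ v, L v = ∑ w : S × A, softmaxPolicy θ w.1 w.2 * (ρ.real {w.1} * M.resolventOp θ
        (fun z => inner ℝ v (score θ z) * M.resolventOp θ (M.regReward lam θ) z) w) := by
  simp only [regValue_eq_sum]
  obtain ⟨L, hL, hLv⟩ := hasFDerivAt_sum_softmaxPolicy_mul (fun s => ρ.real {s})
    (M.differentiable_resolventOp_regReward lam θ)
  refine ⟨L, hL, fun v => ?_⟩
  have h0 : ∑ w : S × A, softmaxPolicy θ w.1 w.2 * (ρ.real {w.1} * inner ℝ v (score θ w)) = 0 := by
    rw [Fintype.sum_prod_type]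
    refine Finset.sum_eq_zero fun s _ => ?_
    have h := congrArg (ρ.real {s} * ·) (sum_softmaxPolicy_mul_inner_score θ v s)
    simp only [Finset.mul_sum, mul_zero] at h
    rw [← h]
    exact Finset.sum_congr rfl fun a _ => by ring
  -- After `-f` cancels the term from the policy, the two sides differ by `-lam` times the mean
  -- score in `h0`.
  rw [hLv, ← sub_eq_zero, ← Finset.sum_sub_distrib, ← mul_zero (-lam), ← h0, Finset.mul_sum]
  refine Finset.sum_congr rfl fun w _ => ?_
  rw [fderiv_resolventOp_regReward]
  simp only [Pi.sub_apply, Pi.smul_apply, smul_eq_mul]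
  ring

/-! ### Integrability and mean of the estimator. -/

lemma measurable_eval_horizon {α : Type*} [MeasurableSpace α] (f : S × A → α) :
    Measurable fun x : ℕ × (ℕ → S × A) => f (x.2 x.1) :=
  measurable_from_prod_countable_right fun n => measurable_comp_eval f n

lemma integrable_gradEstimator (lam : ℝ) (ρ : Measure S) [IsProbabilityMeasure ρ]
    (θ : EuclideanSpace ℝ (S × A)) :
    Integrable (M.gradEstimator lam θ) (M.samplingLaw ρ θ) := by
  have : IsMarkovKernel (M.rolloutKernel θ) := by unfold rolloutKernel; infer_instance
  have : IsProbabilityMeasure (M.samplingLaw ρ θ) := by unfold samplingLaw; infer_instance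
  set ℓ : S × A → ℝ := fun w => lam * Real.log (softmaxPolicy θ w.1 w.2) with hℓ
  have hm : Measurable (M.gradEstimator lam θ) :=
    ((((M.measurable_qEstimate lam θ).comp measurable_snd).sub
      ((measurable_eval_horizon ℓ).comp measurable_fst)).const_mul _).smul
      ((measurable_eval_horizon (score θ)).comp measurable_fst)
  refine Integrable.of_bound hm.aestronglyMeasurable (‖1 / (1 - M.discount)‖ *
    (‖M.reward‖ + (∑' t : ℕ, √M.discount ^ t) * ‖M.regReward lam θ‖ + ‖ℓ‖) *
      ‖(score θ : S × A → EuclideanSpace ℝ (S × A))‖) (Filter.Eventually.of_forall fun x => ?_)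
  rw [gradEstimator, norm_smul, norm_mul]
  gcongr
  · exact (norm_sub_le _ _).trans (add_le_add (M.norm_qEstimate_le lam θ _)
      (norm_le_pi_norm ℓ _))
  · exact norm_le_pi_norm (score θ : S × A → EuclideanSpace ℝ (S × A)) _

/-- A function of the state-action pair at the random horizon has mean `(1 - γ)` times its
expected discounted sum. -/
lemma integral_eval_horizon (ρ : Measure S) [IsProbabilityMeasure ρ]
    (θ : EuclideanSpace ℝ (S × A)) (f : S × A → ℝ) :
    ∫ x, f (x.2 x.1) ∂(M.horizonLaw.prod (M.trajLaw ρ θ)) = (1 - M.discount) *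
      ∑ w : S × A, softmaxPolicy θ w.1 w.2 * (ρ.real {w.1} * M.resolventOp θ f w) := by
  have hi : Integrable (fun x : ℕ × (ℕ → S × A) => f (x.2 x.1))
      (M.horizonLaw.prod (M.trajLaw ρ θ)) :=
    Integrable.of_bound (measurable_eval_horizon f).aestronglyMeasurable ‖f‖
      (Filter.Eventually.of_forall fun x => norm_le_pi_norm f _)
  have hp : (⟨1 - M.discount, by
    constructor <;> linarith [M.discount_pos, M.discount_lt_one]⟩ : unitInterval) ≠ 0 := by
    intro h
    have := congrArg Subtype.val h
    simp at this
    linarith [M.discount_lt_one]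
  rw [integral_prod _ hi]
  simp only [M.integral_trajLaw ρ θ (integrable_comp_eval _ f _), integral_trajFrom_eval]
  rw [horizonLaw, integral_geometricMeasure hp]
  have h : HasSum (fun n : ℕ => (1 - M.discount) * ∑ w : S × A, softmaxPolicy θ w.1 w.2 *
      (ρ.real {w.1} * (M.discount ^ n * (M.stepOp θ ^ n) f w))) ((1 - M.discount) *
      ∑ w : S × A, softmaxPolicy θ w.1 w.2 * (ρ.real {w.1} * M.resolventOp θ f w)) :=
    (hasSum_sum fun w _ => ((M.hasSum_resolventOp θ f w).mul_left _).mul_left _).mul_left _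
  rw [← h.tsum_eq]
  refine tsum_congr fun n => ?_
  simp only [sub_sub_cancel, smul_eq_mul, Finset.mul_sum]
  exact Finset.sum_congr rfl fun w _ => by ring

lemma inner_integral_gradEstimator (lam : ℝ) (ρ : Measure S) [IsProbabilityMeasure ρ]
    (θ v : EuclideanSpace ℝ (S × A)) :
    inner ℝ v (∫ x, M.gradEstimator lam θ x ∂(M.samplingLaw ρ θ)) =
      ∑ w : S × A, softmaxPolicy θ w.1 w.2 * (ρ.real {w.1} * M.resolventOp θ
        (fun z => inner ℝ v (score θ z) * M.resolventOp θ (M.regReward lam θ) z) w) := by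
  have hmarkov : IsMarkovKernel (M.rolloutKernel θ) := by unfold rolloutKernel; infer_instance
  have hi := M.integrable_gradEstimator lam ρ θ
  have hγ : 1 - M.discount ≠ 0 := by linarith [M.discount_lt_one]
  rw [← integral_inner hi, samplingLaw, Measure.integral_compProd (hi.const_inner v)]
  -- Condition on the first sample: the score is then constant, and the subtracted `lam log π`
  -- cancels the extra term in `integral_qEstimate`.
  have hroll : ∀ x, ∫ y, inner ℝ v (M.gradEstimator lam θ (x, y)) ∂(M.rolloutKernel θ x) =
      (1 / (1 - M.discount)) * (inner ℝ v (score θ (x.2 x.1)) *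
        M.resolventOp θ (M.regReward lam θ) (x.2 x.1)) := fun x => by
    have hx : M.rolloutKernel θ x = M.rolloutHorizonLaw.prod (M.trajFrom θ (x.2 x.1)) := by
      rw [rolloutKernel, Kernel.prod_apply, Kernel.const_apply, Kernel.comap_apply]
    rw [hx]
    simp only [gradEstimator, inner_smul_right]
    rw [integral_mul_const, integral_const_mul, integral_sub, integral_qEstimate, integral_const]
    · simp; ring
    · exact Integrable.of_bound (M.measurable_qEstimate lam θ).aestronglyMeasurable _
        (Filter.Eventually.of_forall (M.norm_qEstimate_le lam θ))
    · exact integrable_const _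
  simp only [hroll]
  rw [integral_const_mul, M.integral_eval_horizon ρ θ
    (fun z => inner ℝ v (score θ z) * M.resolventOp θ (M.regReward lam θ) z), ← mul_assoc,
    one_div_mul_cancel hγ, one_mul]

end DiscountedMDP

theorem mainTheorem5 {S A : Type*} [Fintype S] [Fintype A] [Nonempty A]
    [MeasurableSpace S] [DiscreteMeasurableSpace S] [MeasurableSpace A] [DiscreteMeasurableSpace A]
    (M : DiscountedMDP S A) (ρ : Measure S) [IsProbabilityMeasure ρ] (lam : ℝ)
    (θ : EuclideanSpace ℝ (S × A)) :
    DifferentiableAt ℝ (fun ϑ => M.regValue lam ρ ϑ) θ ∧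
    Integrable (M.gradEstimator lam θ) (M.samplingLaw ρ θ) ∧
    ∫ x, M.gradEstimator lam θ x ∂(M.samplingLaw ρ θ) =
      gradient (fun ϑ => M.regValue lam ρ ϑ) θ := by
  obtain ⟨L, hL, hLv⟩ := M.hasFDerivAt_regValue lam ρ θ
  refine ⟨hL.differentiableAt, M.integrable_gradEstimator lam ρ θ, ext_inner_left ℝ fun v => ?_⟩
  rw [M.inner_integral_gradEstimator, ← hLv, real_inner_comm, gradient,
    InnerProductSpace.toDual_symm_apply, hL.fderiv]
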